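/- Let $D\in\mathbb{N}$ and let $(\mathcal{M}_j)_{j\in J}$ be a countable family of subsets of $\mathbb{R}^D$ such that each $\mathcal{M}_j$ is a smooth $d_j$-dimensional embedded submanifold (without boundary) of $\mathbb{R}^D$, and such that $$\xi := \inf_{i\neq j}\ \inf_{x_i\in\mathcal{M}_i,\,x_j\in\mathcal{M}_j}\|x_i-x_j\| > 0 .$$ Let $\mathcal{M}=\bigcup_j\mathcal{M}_j$, equipped with the measure $\mathrm{d}x'$ that on each $\mathcal{M}_j$ is the Riemannian measure of the metric induced from $\mathbb{R}^D$. Let $\pi_j>0$ with $\sum_j\pi_j=1$, let $p_j:\mathcal{M}_j\to[0,\infty)$ be a probability density with respect to the Riemannian measure of $\mathcal{M}_j$ for every $j$, and let $p:\mathcal{M}\to\mathbb{R}$ be the probability density given by $p(x)=\pi_jp_j(x)$ for $x\in\mathcal{M}_j$. For $x\in\mathbb{R}^D$ and $\delta\in\mathbb{R}$ put $$\varrho_{\mathcal{N}}(x,\delta) := \int_{\mathcal{M}} p(x')\,(2\pi)^{-D/2}e^{-D\delta}\exp\!\Big(-\tfrac12\|x-x'\|^2e^{-2\delta}\Big)\,\mathrm{d}x'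 .$$ Let $x\in\mathcal{M}_i$ for some $i$ be such that $p_i$ is continuous at $x$, $p_i(x)>0$, and $$\int_{\mathcal{M}_i}p_i(x')\,\mathrm{dist}_{\mathcal{M}_i}^2(x,x')\,\mathrm{d}x'<\infty ,$$ where $\mathrm{dist}_{\mathcal{M}_i}$ is the geodesic distance on $\mathcal{M}_i$ of the induced Riemannian metric ($\infty$ between different connected components, with the convention $0\cdot\infty=0$). Then the integral defining $\varrho_{\mathcal{N}}(x,\delta)$ converges and is positive for every $\delta\in\mathbb{R}$, the function $\delta\mapsto\log\varrho_{\mathcal{N}}(x,\delta)$ is differentiable on $\mathbb{R}$, and $$\lim_{\delta\to-\infty}\frac{\partial}{\partial\delta}\log\varrho_{\mathcal{N}}(x,\delta) = d_i-D .$$ -/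

import Mathlib

open MeasureTheory Filter Topology Manifold
open scoped ENNReal ContDiff

noncomputable section

namespace GaussianLID

/-- `D`-dimensional Euclidean space `ℝ^D`, with the Euclidean norm. -/
abbrev Euc (D : ℕ) : Type := EuclideanSpace ℝ (Fin D)

/-- The isotropic Gaussian density `N_D(x; μ, δ)` on `ℝ^D` with mean `μ` and log standard
deviation `δ`. -/
def gaussianDensity {D : ℕ} (x μ : Euc D) (δ : ℝ) : ℝ :=
  (2 * Real.pi) ^ (-(D : ℝ) / 2) * Real.exp (-(D : ℝ) * δ) *
    Real.exp (-(1 / 2) * ‖x - μ‖ ^ 2 * Real.exp (-2 * δ))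

section Submanifold

variable {D d : ℕ} (S : Set (Euc D)) [ChartedSpace (Euc d) S]

/-- `S`, with the subspace topology and the given atlas, is a smooth `d`-dimensional embedded
submanifold of `ℝ^D` (without boundary): the atlas is smooth and the inclusion of `S` into `ℝ^D`
is a smooth embedding. -/
structure IsEmbeddedSubmanifold : Prop where
  isManifold : IsManifold (𝓡 d) ∞ S
  isSmoothEmbedding : IsSmoothEmbedding (𝓡 d) (𝓡 D) ∞ (Subtype.val : S → Euc D)

/-- The determinant `det (g_{ij}(y))` of the induced Riemannian metric in the chart `e`, at the
point with coordinates `y`, where `g_{ij} = ⟨∂_i F, ∂_j F⟩` for the parametrization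
`F = e⁻¹` regarded as a map into `ℝ^D`. -/
def metricDet (e : OpenPartialHomeomorph S (Euc d)) (y : Euc d) : ℝ :=
  (Matrix.gram ℝ fun i : Fin d =>
    fderiv ℝ (fun z => (e.symm z : Euc D)) y (EuclideanSpace.single i 1)).det

/-- The measure on `S` which is `√(det g) dy` in the chart `e`, and vanishes off the domain of
this chart. -/
def chartVolume (e : OpenPartialHomeomorph S (Euc d)) : Measure S :=
  ((volume.restrict e.target).withDensity
    fun y => ENNReal.ofReal (Real.sqrt (metricDet S e y))).map e.symm

/-- The Riemannian measure of `S` for the Riemannian metric induced from `ℝ^D`. The measures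
`√(det g) dy` of the smooth charts agree on overlaps of chart domains, so their supremum is the
measure on `S` that is `√(det g) dy` in every smooth chart. -/
def riemannianVolume : Measure S :=
  ⨆ e ∈ IsManifold.maximalAtlas (𝓡 d) ∞ S, chartVolume S e

variable {S}

/-- The geodesic distance on `S` of the induced Riemannian metric: the infimum of the lengths of
`C^1` paths in `S`, where a tangent vector to `S` has the Euclidean norm of its image in `ℝ^D`.
It is `∞` between points of different connected components. -/
def geodesicEDist (x y : S) : ℝ≥0∞ :=
  letI : ∀ z : S, ENorm (TangentSpace (𝓡 d) z) := fun z =>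
    ⟨fun v =>
      let u : Euc D := mfderiv (𝓡 d) (𝓡 D) (Subtype.val : S → Euc D) z v
      ‖u‖ₑ⟩
  riemannianEDist (𝓡 d) x y

end Submanifold

/-- `q` is a probability density function with respect to `μ`. -/
structure IsProbDensity {X : Type*} [MeasurableSpace X] (μ : Measure X) (q : X → ℝ) : Prop where
  aemeasurable : AEMeasurable q μ
  nonneg : ∀ x, 0 ≤ q x
  lintegral_eq_one : ∫⁻ x, ENNReal.ofReal (q x) ∂μ = 1

section Union

variable {D : ℕ} {J : Type*} (M : J → Set (Euc D))

/-- The separation `ξ`: the infimum of the distances between points of two different members of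
the family `M`. -/
def separation : ℝ≥0∞ :=
  ⨅ (i : J) (j : J) (_ : i ≠ j) (x ∈ M i) (y ∈ M j), edist x y

/-- The Riemannian measure of the disjoint union of the submanifolds `M j`: on each `M j` it is
the Riemannian measure of `M j`. -/
def unionVolume (d : J → ℕ) [∀ j, ChartedSpace (Euc (d j)) (M j)] :
    Measure (⋃ j, M j : Set (Euc D)) :=
  Measure.sum fun j => (riemannianVolume (d := d j) (M j)).map
    (Set.inclusion (Set.subset_iUnion M j))

end Union

/-- The Gaussian convolution `ϱ_N(x, δ) = ∫_S p(x') N_D(x - x'; 0, δ) dx'`, where `dx'` is the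
measure `μ` on `S`. -/
def gaussianConv {D : ℕ} {S : Set (Euc D)} (μ : Measure S) (p : S → ℝ) (x : Euc D) (δ : ℝ) : ℝ :=
  ∫ x' : S, p x' * gaussianDensity (x - (x' : Euc D)) 0 δ ∂μ

end GaussianLID

end

noncomputable section

namespace GaussianLID

/-! ### Gaussian integrals and Laplace asymptotics on Euclidean space -/

section Laplace

open Module ProbabilityTheory

variable {E F : Type*} [NormedAddCommGroup E] [InnerProductSpace ℝ E] [FiniteDimensional ℝ E]
  [MeasurableSpace E] [BorelSpace E] [NormedAddCommGroup F] [NormedSpace ℝ F]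

/-! Let `P` be the probability measure with density `p` on the union, and let `R z = ‖x - z‖ ^ 2`.
Up to the factor `(2π)^(-D/2) e^(-Dδ)`, the Gaussian convolution is the moment generating function
of `R` under `P` at `-r² / 2`, where `r = e^(-δ)`. Since `R ≥ 0`, this function is finite, positive
and differentiable at negative arguments. The logarithmic derivative is therefore `-D` plus the
quotient of `∫ r² R e^(-r² R / 2) dP` by `∫ e^(-r² R / 2) dP`, and the claim is that this quotient
tends to `d i` as `r → ∞`.

Both integrals have the form `∫ φ(r² R) dP` with `φ` exponentially decaying. In a chart at `x`, the
substitution `y = y₀ + u / r` shows that a small neighbourhood contributes `r^(-d) a ∫ φ(‖A u‖²) du`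
to leading order, with `A` the injective derivative of the parametrization and `a > 0` independent
of `φ` (`tendsto_pow_mul_setIntegral`, `exists_tendsto_pow_mul_setIntegral`). Since the pieces are
embedded and uniformly separated, `R` is bounded below off this neighbourhood, and the rest is
exponentially small (`tendsto_pow_mul_setIntegral_of_le`). In the quotient `r^d` and `a` cancel,
leaving the second moment of a nondegenerate Gaussian divided by its mass, which is the dimension
whatever `A` is (`integral_sq_norm_mul_exp_neg`). -/

lemma integrable_exp_neg_mul_sq_norm {b : ℝ} (hb : 0 < b) :
    Integrable fun v : E => Real.exp (-b * ‖v‖ ^ 2) := by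
  have h := GaussianFourier.integrable_cexp_neg_mul_sq_norm_add (V := E) (b := (b : ℂ))
    (by simpa using hb) 0 0
  refine h.norm.congr (ae_of_all _ fun v => ?_)
  simp only [zero_mul, add_zero, Complex.norm_exp]
  congr 1
  rw [← Complex.ofReal_neg, Complex.re_ofReal_mul, ← Complex.ofReal_pow, Complex.ofReal_re]

omit [MeasurableSpace E] [BorelSpace E] in
lemma exists_pos_mul_norm_le {A : E →L[ℝ] F} (hA : Function.Injective A) :
    ∃ c > 0, ∀ u, c * ‖u‖ ≤ ‖A u‖ := by
  obtain ⟨K, hK, h⟩ := (A : E →ₗ[ℝ] F).exists_antilipschitzWith (LinearMap.ker_eq_bot.2 hA)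
  refine ⟨(K : ℝ)⁻¹, by positivity, fun u => ?_⟩
  have := h.le_mul_dist u 0
  simp only [dist_zero_right, map_zero, ContinuousLinearMap.coe_coe] at this
  rw [inv_mul_le_iff₀ (by positivity)]
  exact this

lemma integrable_exp_neg_mul_sq_norm_clm {A : E →L[ℝ] F} (hA : Function.Injective A) {b : ℝ}
    (hb : 0 < b) : Integrable fun v : E => Real.exp (-b * ‖A v‖ ^ 2) := by
  obtain ⟨c, hc, h⟩ := exists_pos_mul_norm_le hA
  refine (integrable_exp_neg_mul_sq_norm (E := E) (b := b * c ^ 2) (by positivity)).mono'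
    (by fun_prop) (ae_of_all _ fun v => ?_)
  rw [Real.norm_eq_abs, Real.abs_exp, Real.exp_le_exp]
  have := pow_le_pow_left₀ (by positivity) (h v) 2
  nlinarith

lemma integral_exp_neg_sq_norm_pos {A : E →L[ℝ] F} (hA : Function.Injective A) :
    0 < ∫ v : E, Real.exp (-(1 / 2) * ‖A v‖ ^ 2) :=
  integral_exp_pos (integrable_exp_neg_mul_sq_norm_clm hA (by norm_num))

/-- The second moment of a Gaussian on a `d`-dimensional space equals `d`, for an arbitrary
nondegenerate quadratic form. -/
lemma integral_sq_norm_mul_exp_neg {A : E →L[ℝ] F} (hA : Function.Injective A) :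
    ∫ v : E, ‖A v‖ ^ 2 * Real.exp (-(1 / 2) * ‖A v‖ ^ 2) =
      finrank ℝ E * ∫ v : E, Real.exp (-(1 / 2) * ‖A v‖ ^ 2) := by
  set X : E → ℝ := fun v => ‖A v‖ ^ 2
  have hsub : Set.Iio (0 : ℝ) ⊆ integrableExpSet X volume := fun t ht => by
    have := integrable_exp_neg_mul_sq_norm_clm hA (b := -t) (by simpa using ht)
    rwa [neg_neg] at this
  have hd := hasDerivAt_mgf (X := X) (μ := volume) (t := -(1 / 2))
    (interior_mono hsub (by rw [interior_Iio]; norm_num))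
  -- Dilating `v` by `t` gives this scaling law. Differentiating both sides at `t = 1` yields the
  -- second moment without diagonalizing the quadratic form.
  have hscale : ∀ t : ℝ, 0 < t → mgf X volume (-(1 / 2) * t ^ 2) =
      (t ^ finrank ℝ E)⁻¹ * mgf X volume (-(1 / 2)) := fun t ht => by
    have := Measure.integral_comp_smul (volume : Measure E)
      (fun v => Real.exp (-(1 / 2) * ‖A v‖ ^ 2)) t
    rw [abs_of_pos (by positivity), smul_eq_mul] at this
    rw [mgf, mgf, ← this]
    refine integral_congr_ae (ae_of_all _ fun v => ?_)
    simp only [X, map_smul, norm_smul, Real.norm_eq_abs, mul_pow, sq_abs]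
    ring_nf
  have h1 : HasDerivAt (fun t : ℝ => mgf X volume (-(1 / 2) * t ^ 2))
      ((∫ v, X v * Real.exp (-(1 / 2) * X v)) * (-1)) 1 := by
    refine HasDerivAt.comp (h₂ := mgf X volume) (h := fun t : ℝ => -(1 / 2) * t ^ 2) 1
      (by simpa using hd) ?_
    convert! (hasDerivAt_pow 2 (1 : ℝ)).const_mul (-(1 / 2) : ℝ) using 1
    norm_num
  have h2 : HasDerivAt (fun t : ℝ => (t ^ finrank ℝ E)⁻¹ * mgf X volume (-(1 / 2)))
      (-(finrank ℝ E : ℝ) * mgf X volume (-(1 / 2))) 1 := by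
    refine HasDerivAt.mul_const ?_ _
    convert! (hasDerivAt_pow (finrank ℝ E) (1 : ℝ)).inv (by simp) using 1
    simp
  have h3 := h1.unique (h2.congr_of_eventuallyEq <| by
    filter_upwards [lt_mem_nhds (one_pos)] with t ht using hscale t ht)
  simp only [mgf] at h3
  linarith

/-- Laplace asymptotics: if `G` has injective derivative `A` at `y₀`, then
`r ^ d ∫_s h(y) φ(r² ‖G y - G y₀‖²) dy` tends to `h(y₀) ∫ φ(‖A u‖²) du` as `r → ∞`. -/
lemma tendsto_pow_mul_setIntegral {G : E → F} {A : E →L[ℝ] F} {y₀ : E}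
    (hG : HasFDerivAt G A y₀) {s : Set E} (hs : MeasurableSet s) (hsn : s ∈ 𝓝 y₀)
    {c : ℝ} (hc : 0 < c) (hcG : ∀ y ∈ s, c * ‖y - y₀‖ ≤ ‖G y - G y₀‖)
    (hGm : AEStronglyMeasurable G (volume.restrict s))
    {h : E → ℝ} (hhm : AEStronglyMeasurable h (volume.restrict s)) {C : ℝ}
    (hC : ∀ y ∈ s, |h y| ≤ C) (hh : ContinuousAt h y₀) {φ : ℝ → ℝ} (hφ : Continuous φ) {K : ℝ}
    (hK : ∀ t, 0 ≤ t → |φ t| ≤ K * Real.exp (-(1 / 4) * t)) :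
    Tendsto (fun r : ℝ => r ^ finrank ℝ E * ∫ y in s, h y * φ (r ^ 2 * ‖G y - G y₀‖ ^ 2)) atTop
      (𝓝 (h y₀ * ∫ u, φ (‖A u‖ ^ 2))) := by
  -- Extension by zero keeps the domain of integration equal to `E` after rescaling, so that
  -- dominated convergence applies.
  let f : ℝ → E → ℝ := fun r => s.indicator fun y => h y * φ (r ^ 2 * ‖G y - G y₀‖ ^ 2)
  have hfm : ∀ r, AEStronglyMeasurable (f r) volume := fun r => by
    refine (aestronglyMeasurable_indicator_iff hs).2 (hhm.mul ?_)
    exact hφ.comp_aestronglyMeasurable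
      (((hGm.sub aestronglyMeasurable_const).norm.pow 2).const_mul _)
  have hscale : ∀ r : ℝ, 0 < r → r ^ finrank ℝ E *
      ∫ y in s, h y * φ (r ^ 2 * ‖G y - G y₀‖ ^ 2) = ∫ u, f r (y₀ + r⁻¹ • u) := fun r hr => by
    rw [Measure.integral_comp_smul volume (fun u => f r (y₀ + u)) r⁻¹,
      integral_add_left_eq_self (f r) y₀, integral_indicator hs, smul_eq_mul,
      abs_of_pos (by positivity)]
    simp
  rw [← integral_const_mul]
  have hK0 : 0 ≤ K := by
    have := (abs_nonneg _).trans (hK 0 le_rfl)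
    simpa using this
  have hC0 : 0 ≤ C := (abs_nonneg _).trans (hC _ (mem_of_mem_nhds hsn))
  -- At `y = y₀ + u / r` in `s`, the lower bound `hcG` gives `r * ‖G y - G y₀‖ ≥ c * ‖u‖`; with the
  -- decay rate `1 / 4` of `φ` this produces the rate `c ^ 2 / 4` of the dominating Gaussian.
  refine Tendsto.congr'
    (by filter_upwards [eventually_gt_atTop 0] with r hr using (hscale r hr).symm)
    (tendsto_integral_filter_of_dominated_convergence
      (fun u => C * (K * Real.exp (-(c ^ 2 / 4) * ‖u‖ ^ 2))) ?_ ?_ ?_ ?_)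
  · filter_upwards [eventually_gt_atTop 0] with r hr
    refine (hfm r).comp_quasiMeasurePreserving ⟨by fun_prop, ?_⟩
    have h1 : Measure.map (fun u : E => y₀ + r⁻¹ • u) volume =
        Measure.map (fun u => y₀ + u) (Measure.map (fun u : E => r⁻¹ • u) volume) := by
      rw [Measure.map_map (by fun_prop) (by fun_prop)]; rfl
    rw [h1, Measure.map_addHaar_smul _ (by positivity), Measure.map_smul,
      map_add_left_eq_self]
    exact Measure.smul_absolutelyContinuous
  · filter_upwards [eventually_gt_atTop 0] with r hr
    refine ae_of_all _ fun u => ?_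
    by_cases hu : y₀ + r⁻¹ • u ∈ s
    · simp only [f, Set.indicator_of_mem hu, norm_mul, Real.norm_eq_abs]
      refine mul_le_mul (hC _ hu) ((hK _ (by positivity)).trans ?_) (abs_nonneg _) hC0
      refine mul_le_mul_of_nonneg_left (Real.exp_le_exp.2 ?_) hK0
      have h1 := hcG _ hu
      rw [add_sub_cancel_left, norm_smul, norm_inv, Real.norm_of_nonneg hr.le] at h1
      have h2 : c * ‖u‖ ≤ r * ‖G (y₀ + r⁻¹ • u) - G y₀‖ := by
        have := mul_le_mul_of_nonneg_left h1 hr.le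
        calc c * ‖u‖ = r * (c * (r⁻¹ * ‖u‖)) := by field_simp
          _ ≤ _ := this
      have h3 := pow_le_pow_left₀ (by positivity) h2 2
      rw [mul_pow, mul_pow] at h3
      linarith
    · simp only [f, Set.indicator_of_notMem hu, norm_zero]
      positivity
  · exact ((integrable_exp_neg_mul_sq_norm (by positivity)).const_mul _).const_mul _
  · refine ae_of_all _ fun u => ?_
    have hy : Tendsto (fun r : ℝ => y₀ + r⁻¹ • u) atTop (𝓝 y₀) := by
      have := ((tendsto_inv_atTop_zero (𝕜 := ℝ)).smul_const u).const_add y₀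
      rwa [zero_smul, add_zero] at this
    have h1 : Tendsto (fun r : ℝ => h (y₀ + r⁻¹ • u) *
        φ (‖r • (G (y₀ + r⁻¹ • u) - G y₀)‖ ^ 2)) atTop (𝓝 (h y₀ * φ (‖A u‖ ^ 2))) := by
      refine (hh.tendsto.comp hy).mul ((hφ.tendsto _).comp (Tendsto.pow (Tendsto.norm ?_) 2))
      -- The rescaled increment `r • (G (y₀ + r⁻¹ • u) - G y₀)` is a difference quotient with limit
      -- `A u`.
      exact hG.lim u (tendsto_norm_atTop_atTop)
    refine h1.congr' ?_
    filter_upwards [hy.eventually_mem hsn] with r hr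
    simp only [f, Set.indicator_of_mem hr, norm_smul, mul_pow, Real.norm_eq_abs, sq_abs]

end Laplace

/-! ### The induced metric and the Riemannian measure in charts -/

section Chart

variable {D d : ℕ}

/-- With `N` the matrix of `B`, bilinearity turns the Gram matrix into `Nᵀ * gram * N`. This is the
transformation rule of the metric under a change of chart. -/
lemma det_gram_comp (L : Euc d →L[ℝ] Euc D) (B : Euc d →L[ℝ] Euc d) :
    (Matrix.gram ℝ fun i : Fin d => (L.comp B) (EuclideanSpace.single i 1)).det =
      B.det ^ 2 * (Matrix.gram ℝ fun i : Fin d => L (EuclideanSpace.single i 1)).det := by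
  let b := (EuclideanSpace.basisFun (Fin d) ℝ).toBasis
  let N := LinearMap.toMatrix b b (B : Euc d →ₗ[ℝ] Euc d)
  have hB : ∀ i, B (EuclideanSpace.single i 1) = ∑ k, N k i • EuclideanSpace.single k (1 : ℝ) := by
    intro i
    have := b.sum_repr (B (b i))
    simpa [b, N, LinearMap.toMatrix_apply] using this.symm
  have h : (Matrix.gram ℝ fun i : Fin d => (L.comp B) (EuclideanSpace.single i 1)) =
      N.transpose * (Matrix.gram ℝ fun i : Fin d => L (EuclideanSpace.single i 1)) * N := by
    ext i j
    simp only [Matrix.gram_apply, ContinuousLinearMap.comp_apply, hB, map_sum, map_smul,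
      sum_inner, inner_sum, real_inner_smul_left, real_inner_smul_right, Matrix.mul_apply,
      Matrix.transpose_apply, Finset.sum_mul]
    exact Finset.sum_congr rfl fun k _ => Finset.sum_congr rfl fun l _ => by
      ring
  have hN : N.det = B.det := LinearMap.det_toMatrix b _
  rw [h, Matrix.det_mul, Matrix.det_mul, Matrix.det_transpose, hN]
  ring

variable {S : Set (Euc D)} [ChartedSpace (Euc d) S]

lemma IsEmbeddedSubmanifold.contDiffOn_symm (hS : IsEmbeddedSubmanifold (d := d) S)
    {e : OpenPartialHomeomorph S (Euc d)} (he : e ∈ IsManifold.maximalAtlas (𝓡 d) ∞ S) :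
    ContDiffOn ℝ ∞ (fun z => (e.symm z : Euc D)) e.target :=
  (hS.isSmoothEmbedding.contMDiff.comp_contMDiffOn
    (contMDiffOn_symm_of_mem_maximalAtlas he)).contDiffOn

lemma contDiffOn_transition {e e' : OpenPartialHomeomorph S (Euc d)}
    (he : e ∈ IsManifold.maximalAtlas (𝓡 d) ∞ S) (he' : e' ∈ IsManifold.maximalAtlas (𝓡 d) ∞ S) :
    ContDiffOn ℝ ∞ (fun z => e (e'.symm z)) (e'.symm.trans e).source := by
  refine ContMDiffOn.contDiffOn ?_
  rw [OpenPartialHomeomorph.trans_source]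
  exact (contMDiffOn_of_mem_maximalAtlas he).comp
    ((contMDiffOn_symm_of_mem_maximalAtlas he').mono Set.inter_subset_left) fun z hz => hz.2

lemma differentiableAt_transition {e e' : OpenPartialHomeomorph S (Euc d)}
    (he : e ∈ IsManifold.maximalAtlas (𝓡 d) ∞ S) (he' : e' ∈ IsManifold.maximalAtlas (𝓡 d) ∞ S)
    {y : Euc d} (hy : y ∈ (e'.symm.trans e).source) :
    DifferentiableAt ℝ (fun z => e (e'.symm z)) y :=
  ((contDiffOn_transition he he').contDiffAt
    ((e'.symm.trans e).open_source.mem_nhds hy)).differentiableAt (by simp)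

lemma IsEmbeddedSubmanifold.differentiableAt_symm (hS : IsEmbeddedSubmanifold (d := d) S)
    {e : OpenPartialHomeomorph S (Euc d)} (he : e ∈ IsManifold.maximalAtlas (𝓡 d) ∞ S)
    {y : Euc d} (hy : y ∈ e.target) :
    DifferentiableAt ℝ (fun z => (e.symm z : Euc D)) y :=
  ((hS.contDiffOn_symm he).contDiffAt (e.open_target.mem_nhds hy)).differentiableAt (by simp)

/-- An immersion has, locally, a differentiable left inverse in charts, so that its differential
is injective. -/
lemma IsEmbeddedSubmanifold.injective_fderiv (hS : IsEmbeddedSubmanifold (d := d) S)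
    {e : OpenPartialHomeomorph S (Euc d)} (he : e ∈ IsManifold.maximalAtlas (𝓡 d) ∞ S)
    {y : Euc d} (hy : y ∈ e.target) :
    Function.Injective (fderiv ℝ (fun z => (e.symm z : Euc D)) y) := by
  set x := e.symm y
  have him := hS.isSmoothEmbedding.isImmersion.isImmersionAt x
  set ψ := him.domChart
  set κ := him.codChart
  have hxψ : x ∈ ψ.source := him.mem_domChart_source
  have hw : ∀ z ∈ ψ.target, κ (ψ.symm z : Euc D) = him.equiv (z, 0) := fun z hz => by
    have := him.writtenInCharts (show z ∈ (him.domChart.extend (𝓡 d)).target by simpa using hz)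
    simpa using this
  have hκ : DifferentiableAt ℝ κ (x : Euc D) := by
    have h1 : ContDiffOn ℝ ∞ κ κ.source :=
      (contMDiffOn_of_mem_maximalAtlas him.codChart_mem_maximalAtlas).contDiffOn
    exact (h1.contDiffAt (κ.open_source.mem_nhds him.mem_codChart_source)).differentiableAt
      (by simp)
  -- In the immersion charts the inclusion reads `z ↦ (z, 0)`, so the first component of the ambient
  -- chart recovers `ψ`. Following it with the transition from `ψ` to `e` gives a differentiable
  -- left inverse of `e.symm` near `y`.
  let P : Euc D → Euc d := fun v => (him.equiv.symm (κ v)).1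
  have hP : DifferentiableAt ℝ P (x : Euc D) :=
    (him.equiv.symm.differentiable.differentiableAt.comp _ hκ).fst
  have hPψ : ∀ z ∈ ψ.source, P (z : Euc D) = ψ z := fun z hz => by
    have := hw (ψ z) (ψ.map_source hz)
    rw [ψ.left_inv hz] at this
    simp [P, this]
  have hyτ : ψ x ∈ (ψ.symm.trans e).source := by
    rw [OpenPartialHomeomorph.trans_source]
    exact ⟨ψ.map_source hxψ, by simpa [ψ.left_inv hxψ] using e.map_target hy⟩
  have hτ : DifferentiableAt ℝ (fun z => e (ψ.symm z)) (P x) := by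
    rw [hPψ x hxψ]
    exact differentiableAt_transition he him.domChart_mem_maximalAtlas hyτ
  have hcomp := (hτ.hasFDerivAt.comp (x : Euc D) hP.hasFDerivAt).comp y
    (f := fun z => (e.symm z : Euc D)) (hS.differentiableAt_symm he hy).hasFDerivAt
  have hid : (((fun z => e (ψ.symm z)) ∘ P) ∘ fun z => (e.symm z : Euc D)) =ᶠ[𝓝 y] id := by
    have h1 : ∀ᶠ z in 𝓝 y, e.symm z ∈ ψ.source :=
      (e.symm.continuousAt hy).eventually_mem (ψ.open_source.mem_nhds hxψ)
    filter_upwards [h1, e.open_target.mem_nhds hy] with z hz hz'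
    simp only [Function.comp_apply, hPψ _ hz, ψ.left_inv hz, e.right_inv hz', id]
  have := (hcomp.congr_of_eventuallyEq hid.symm).unique (hasFDerivAt_id y)
  intro u v huv
  have h2 := fun w => DFunLike.congr_fun this w
  have hu := h2 u
  have hv := h2 v
  simp only [ContinuousLinearMap.comp_apply, ContinuousLinearMap.id_apply] at hu hv
  rw [← hu, ← hv, huv]

lemma IsEmbeddedSubmanifold.metricDet_pos (hS : IsEmbeddedSubmanifold (d := d) S)
    {e : OpenPartialHomeomorph S (Euc d)} (he : e ∈ IsManifold.maximalAtlas (𝓡 d) ∞ S)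
    {y : Euc d} (hy : y ∈ e.target) : 0 < metricDet S e y := by
  refine (Matrix.posDef_gram_of_linearIndependent ?_).det_pos
  have h : LinearIndependent ℝ fun i : Fin d => EuclideanSpace.single i (1 : ℝ) := by
    convert! (EuclideanSpace.basisFun (Fin d) ℝ).toBasis.linearIndependent using 2 with i
    simp
  exact h.map' (fderiv ℝ (fun z => (e.symm z : Euc D)) y : Euc d →ₗ[ℝ] Euc D)
    (LinearMap.ker_eq_bot.2 (hS.injective_fderiv he hy))

lemma IsEmbeddedSubmanifold.continuousOn_metricDet (hS : IsEmbeddedSubmanifold (d := d) S)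
    {e : OpenPartialHomeomorph S (Euc d)} (he : e ∈ IsManifold.maximalAtlas (𝓡 d) ∞ S) :
    ContinuousOn (metricDet S e) e.target := by
  have h := (hS.contDiffOn_symm he).continuousOn_fderiv_of_isOpen e.open_target (by simp)
  rw [continuousOn_iff_continuous_domRestrict] at h ⊢
  refine Continuous.matrix_det (continuous_matrix ?_)
  intro i j
  exact (h.clm_apply continuous_const).inner (h.clm_apply continuous_const)

lemma IsEmbeddedSubmanifold.metricDet_transition (hS : IsEmbeddedSubmanifold (d := d) S)
    {e e' : OpenPartialHomeomorph S (Euc d)}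
    (he : e ∈ IsManifold.maximalAtlas (𝓡 d) ∞ S) (he' : e' ∈ IsManifold.maximalAtlas (𝓡 d) ∞ S)
    {y : Euc d} (hy : y ∈ (e'.symm.trans e).source) :
    metricDet S e' y =
      (fderiv ℝ (fun z => e (e'.symm z)) y).det ^ 2 * metricDet S e (e (e'.symm y)) := by
  have hy' := hy
  rw [OpenPartialHomeomorph.trans_source] at hy'
  have h1 := (hS.differentiableAt_symm he (e.map_source hy'.2)).hasFDerivAt.comp y
    (f := fun z => e (e'.symm z)) (differentiableAt_transition he he' hy).hasFDerivAt
  have h2 : (fun z => (e'.symm z : Euc D)) =ᶠ[𝓝 y]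
      (fun z => (e.symm z : Euc D)) ∘ fun z => e (e'.symm z) := by
    filter_upwards [(e'.symm.trans e).open_source.mem_nhds hy] with z hz
    rw [OpenPartialHomeomorph.trans_source] at hz
    simp only [Function.comp_apply, e.left_inv hz.2]
  rw [metricDet, (h1.congr_of_eventuallyEq h2).fderiv, det_gram_comp, metricDet]

omit [ChartedSpace (Euc d) S] in
lemma aemeasurable_symm (e : OpenPartialHomeomorph S (Euc d)) (f : Euc d → ℝ≥0∞) :
    AEMeasurable e.symm ((volume.restrict e.target).withDensity f) :=
  (e.continuousOn_symm.aemeasurable e.open_target.measurableSet).mono_ac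
    (withDensity_absolutelyContinuous _ _)

omit [ChartedSpace (Euc d) S] in
lemma chartVolume_apply (e : OpenPartialHomeomorph S (Euc d)) {A : Set S}
    (hA : MeasurableSet A) :
    chartVolume S e A = ∫⁻ y in e.symm ⁻¹' A ∩ e.target,
      ENNReal.ofReal (Real.sqrt (metricDet S e y)) := by
  rw [chartVolume, Measure.map_apply_of_aemeasurable (aemeasurable_symm e _) hA,
    withDensity_apply', Measure.restrict_restrict' e.open_target.measurableSet]

omit [ChartedSpace (Euc d) S] in
lemma measurableSet_preimage_inter_target (e : OpenPartialHomeomorph S (Euc d)) {A : Set S}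
    (hA : MeasurableSet A) : MeasurableSet (e.symm ⁻¹' A ∩ e.target) := by
  have h := (continuousOn_iff_continuous_domRestrict.1 e.continuousOn_symm).measurable hA
  have := e.open_target.measurableSet.subtype_image h
  convert! this using 1
  ext y
  simp [and_comm]

/-- By `metricDet_transition`, `√(det g)` picks up exactly the absolute Jacobian of the transition
map, which the change of variables formula absorbs. In general there is only an inequality, because
`e'.source` need not cover `e.source`; it suffices for bounding a supremum. -/
lemma IsEmbeddedSubmanifold.chartVolume_restrict_le (hS : IsEmbeddedSubmanifold (d := d) S)
    {e e' : OpenPartialHomeomorph S (Euc d)}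
    (he : e ∈ IsManifold.maximalAtlas (𝓡 d) ∞ S) (he' : e' ∈ IsManifold.maximalAtlas (𝓡 d) ∞ S) :
    (chartVolume S e').restrict e.source ≤ chartVolume S e := by
  refine Measure.le_iff.2 fun A hA => ?_
  have hAe := hA.inter e.open_source.measurableSet
  rw [Measure.restrict_apply hA, chartVolume_apply e' hAe, chartVolume_apply e hA]
  set W := e'.symm ⁻¹' (A ∩ e.source) ∩ e'.target
  have hW : ∀ y ∈ W, y ∈ (e'.symm.trans e).source := fun y hy => by
    rw [OpenPartialHomeomorph.trans_source]
    exact ⟨hy.2, hy.1.2⟩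
  have key := lintegral_image_eq_lintegral_abs_det_fderiv_mul volume
    (measurableSet_preimage_inter_target e' hAe)
    (fun y hy => (differentiableAt_transition he he' (hW y hy)).hasFDerivAt.hasFDerivWithinAt)
    ((e'.symm.trans e).injOn.mono hW)
    (fun y => ENNReal.ofReal (Real.sqrt (metricDet S e y)))
  have hcongr : ∫⁻ y in W, ENNReal.ofReal (Real.sqrt (metricDet S e' y)) =
      ∫⁻ y in W, ENNReal.ofReal |(fderiv ℝ (fun z => e (e'.symm z)) y).det| *
        ENNReal.ofReal (Real.sqrt (metricDet S e (e (e'.symm y)))) := by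
    refine setLIntegral_congr_fun (measurableSet_preimage_inter_target e' hAe) fun y hy => ?_
    rw [hS.metricDet_transition he he' (hW y hy), Real.sqrt_mul (sq_nonneg _), Real.sqrt_sq_eq_abs,
      ENNReal.ofReal_mul (abs_nonneg _)]
  rw [hcongr, ← key]
  refine lintegral_mono_set ?_
  rintro _ ⟨y, hy, rfl⟩
  exact ⟨by simpa [e.left_inv hy.1.2] using hy.1.1, e.map_source hy.1.2⟩

/-- The Riemannian measure is `√(det g) dy` in every smooth chart. -/
lemma IsEmbeddedSubmanifold.riemannianVolume_restrict (hS : IsEmbeddedSubmanifold (d := d) S)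
    {e : OpenPartialHomeomorph S (Euc d)} (he : e ∈ IsManifold.maximalAtlas (𝓡 d) ∞ S) :
    (riemannianVolume (d := d) S).restrict e.source = chartVolume S e := by
  have hm := e.open_source.measurableSet
  have hle : chartVolume S e ≤ riemannianVolume (d := d) S := le_iSup₂_of_le e he le_rfl
  have hsupp : (chartVolume S e).restrict e.source = chartVolume S e := by
    refine Measure.restrict_eq_self_of_ae_mem ?_
    refine (ae_iff.2 ?_)
    change chartVolume S e e.sourceᶜ = 0
    rw [chartVolume_apply e hm.compl]
    have : e.symm ⁻¹' e.sourceᶜ ∩ e.target = ∅ :=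
      Set.eq_empty_of_forall_notMem fun y hy => hy.1 (e.map_target hy.2)
    rw [this, Measure.restrict_empty, lintegral_zero_measure]
  refine le_antisymm ?_ (hsupp ▸ Measure.restrict_mono_measure hle _)
  -- A supremum of measures is not computed set by set, so one measure dominating every chart
  -- measure is needed. Each is split along `e.source`; the second summand disappears on restriction
  -- to `e.source`.
  have hub : riemannianVolume (d := d) S ≤
      chartVolume S e + (riemannianVolume (d := d) S).restrict e.sourceᶜ := by
    refine iSup₂_le fun e' he' => ?_
    rw [← Measure.restrict_add_restrict_compl (μ := chartVolume S e') hm]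
    exact add_le_add (hS.chartVolume_restrict_le he he')
      (Measure.restrict_mono_measure (le_iSup₂_of_le e' he' le_rfl) _)
  refine (Measure.restrict_mono_measure hub _).trans ?_
  rw [Measure.restrict_add, hsupp, Measure.restrict_restrict hm, Set.inter_compl_self,
    Measure.restrict_empty, add_zero]

end Chart

/-! ### Laplace asymptotics on a submanifold -/

section Local

variable {D d : ℕ} {S : Set (Euc D)} [ChartedSpace (Euc d) S]

/-- Integration against the Riemannian measure in a smooth chart. -/
lemma IsEmbeddedSubmanifold.setIntegral_riemannianVolume (hS : IsEmbeddedSubmanifold (d := d) S)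
    {e : OpenPartialHomeomorph S (Euc d)} (he : e ∈ IsManifold.maximalAtlas (𝓡 d) ∞ S)
    {s : Set (Euc d)} (hs : IsOpen s) (hse : s ⊆ e.target) {f : S → ℝ}
    (hf : AEStronglyMeasurable f (riemannianVolume (d := d) S)) :
    ∫ z in e.source ∩ e ⁻¹' s, f z ∂riemannianVolume (d := d) S =
      ∫ y in s, Real.sqrt (metricDet S e y) * f (e.symm y) := by
  have hU : MeasurableSet (e.source ∩ e ⁻¹' s) := (e.isOpen_inter_preimage hs).measurableSet
  have hle : chartVolume S e ≤ riemannianVolume (d := d) S := le_iSup₂_of_le e he le_rfl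
  have h1 : (riemannianVolume (d := d) S).restrict (e.source ∩ e ⁻¹' s) =
      (chartVolume S e).restrict (e.source ∩ e ⁻¹' s) := by
    rw [← hS.riemannianVolume_restrict he, Measure.restrict_restrict hU,
      Set.inter_eq_left.2 Set.inter_subset_left]
  have hpre : e.symm ⁻¹' (e.source ∩ e ⁻¹' s) ∩ e.target = s := by
    ext y
    refine ⟨fun hy => by simpa [e.right_inv hy.2] using hy.1.2, fun hy => ⟨⟨e.map_target (hse hy),
      by simpa [e.right_inv (hse hy)] using hy⟩, hse hy⟩⟩
  have hρ : AEMeasurable (fun y => ENNReal.ofReal (Real.sqrt (metricDet S e y)))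
      (volume.restrict s) :=
    ((hS.continuousOn_metricDet he).mono hse).aemeasurable hs.measurableSet
      |>.sqrt.ennreal_ofReal
  rw [h1, chartVolume, setIntegral_map hU (hf.mono_measure hle) (aemeasurable_symm e _),
    restrict_withDensity', Measure.restrict_restrict' e.open_target.measurableSet, hpre,
    integral_withDensity_eq_integral_toReal_smul₀ hρ (by simp)]
  simp [Real.sqrt_nonneg]

/-- Since `√(det g)` is positive on the chart target, Lebesgue measure there is absolutely
continuous with respect to `√(det g) dy`, so null sets of the Riemannian measure stay null in
coordinates. -/
lemma IsEmbeddedSubmanifold.aemeasurable_comp_symm (hS : IsEmbeddedSubmanifold (d := d) S)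
    {e : OpenPartialHomeomorph S (Euc d)} (he : e ∈ IsManifold.maximalAtlas (𝓡 d) ∞ S)
    {q : S → ℝ} (hq : AEMeasurable q (riemannianVolume (d := d) S)) :
    AEMeasurable (fun y => q (e.symm y)) (volume.restrict e.target) := by
  have hle : chartVolume S e ≤ riemannianVolume (d := d) S := le_iSup₂_of_le e he le_rfl
  refine ((hq.mono_measure hle).comp_aemeasurable (aemeasurable_symm e _)).mono_ac
    (withDensity_absolutelyContinuous' ?_ ?_)
  · exact ((hS.continuousOn_metricDet he).aemeasurable
      e.open_target.measurableSet).sqrt.ennreal_ofReal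
  · filter_upwards [ae_restrict_mem e.open_target.measurableSet] with y hy
    simpa using Real.sqrt_pos.2 (hS.metricDet_pos he hy)

/-- The `o(‖y - y₀‖)` error is absorbed by half of the lower bound for the injective derivative.
This supplies the coercivity that domination in the Laplace limit requires. -/
lemma exists_pos_eventually_mul_norm_le {E F : Type*} [NormedAddCommGroup E]
    [InnerProductSpace ℝ E] [FiniteDimensional ℝ E] [NormedAddCommGroup F] [NormedSpace ℝ F]
    {G : E → F} {A : E →L[ℝ] F} {y₀ : E} (hG : HasFDerivAt G A y₀) (hA : Function.Injective A) :
    ∃ c > 0, ∀ᶠ y in 𝓝 y₀, c * ‖y - y₀‖ ≤ ‖G y - G y₀‖ := by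
  obtain ⟨c, hc, h⟩ := exists_pos_mul_norm_le hA
  refine ⟨c / 2, by positivity, ?_⟩
  filter_upwards [hG.isLittleO.def (half_pos hc)] with y hy
  have h1 := h (y - y₀)
  have h2 := norm_sub_norm_le (A (y - y₀)) (G y - G y₀)
  rw [norm_sub_rev (A _)] at h2
  linarith

/-- Laplace asymptotics on an embedded submanifold, near a point where the density `q` is
continuous and positive. -/
lemma IsEmbeddedSubmanifold.exists_tendsto_pow_mul_setIntegral
    (hS : IsEmbeddedSubmanifold (d := d) S) {q : S → ℝ}
    (hq : AEMeasurable q (riemannianVolume (d := d) S)) {x : S} (hcont : ContinuousAt q x)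
    (hpos : 0 < q x) :
    ∃ U : Set S, IsOpen U ∧ x ∈ U ∧ ∃ A : Euc d →L[ℝ] Euc D, Function.Injective A ∧
      ∃ a : ℝ, 0 < a ∧ ∀ φ : ℝ → ℝ, Continuous φ →
        ∀ K : ℝ, (∀ t, 0 ≤ t → |φ t| ≤ K * Real.exp (-(1 / 4) * t)) →
          Tendsto (fun r : ℝ => r ^ d * ∫ z in U, q z * φ (r ^ 2 * ‖(x : Euc D) - z‖ ^ 2)
            ∂riemannianVolume (d := d) S) atTop (𝓝 (a * ∫ u, φ (‖A u‖ ^ 2))) := by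
  have := hS.isManifold
  set e := chartAt (Euc d) x
  have he : e ∈ IsManifold.maximalAtlas (𝓡 d) ∞ S := IsManifold.chart_mem_maximalAtlas x
  have hx : x ∈ e.source := mem_chart_source _ x
  set y₀ := e x
  have hy₀ : y₀ ∈ e.target := e.map_source hx
  have hex : e.symm y₀ = x := e.left_inv hx
  let G : Euc d → Euc D := fun z => e.symm z
  let h : Euc d → ℝ := fun y => Real.sqrt (metricDet S e y) * q (e.symm y)
  have hG := (hS.differentiableAt_symm he hy₀).hasFDerivAt
  have hA := hS.injective_fderiv he hy₀
  have hh : ContinuousAt h y₀ := by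
    refine ContinuousAt.mul ?_ ?_
    · exact ((hS.continuousOn_metricDet he).continuousAt (e.open_target.mem_nhds hy₀)).sqrt
    · exact ContinuousAt.comp (by rwa [hex]) (e.symm.continuousAt hy₀)
  have h0 : 0 < h y₀ := by
    refine mul_pos (Real.sqrt_pos.2 (hS.metricDet_pos he hy₀)) ?_
    rwa [hex]
  obtain ⟨c, hc, hcG⟩ := exists_pos_eventually_mul_norm_le hG hA
  have hbd : ∀ᶠ y in 𝓝 y₀, |h y| < |h y₀| + 1 :=
    hh.abs.eventually_lt_const (lt_add_one _)
  obtain ⟨s, hsub, hso, hys⟩ := mem_nhds_iff.1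
    ((hcG.and hbd).and (e.open_target.mem_nhds hy₀))
  have hst : s ⊆ e.target := fun y hy => (hsub hy).2
  -- Here `a = h y₀` is `√(det g)` at `y₀` times `q x`. All witnesses are fixed before `φ`, so
  -- numerator and denominator will share them.
  refine ⟨e.source ∩ e ⁻¹' s, e.isOpen_inter_preimage hso, ⟨hx, hys⟩, _, hA, h y₀, h0, ?_⟩
  intro φ hφ K hK
  have hlim := tendsto_pow_mul_setIntegral hG hso.measurableSet (hso.mem_nhds hys) hc
    (fun y hy => (hsub hy).1.1)
    (((hS.contDiffOn_symm he).continuousOn.mono hst).aestronglyMeasurable hso.measurableSet)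
    (h := h) ?_ (fun y hy => (hsub hy).1.2.le) hh hφ hK
  · rw [finrank_euclideanSpace_fin] at hlim
    refine hlim.congr fun r => ?_
    rw [hS.setIntegral_riemannianVolume he hso hst]
    · simp only [h, hex, norm_sub_rev (x : Euc D), mul_assoc]
    · refine hq.aestronglyMeasurable.mul ?_
      have : Continuous fun z : S => φ (r ^ 2 * ‖(x : Euc D) - z‖ ^ 2) := by fun_prop
      exact this.aestronglyMeasurable
  · refine AEMeasurable.aestronglyMeasurable (AEMeasurable.mul ?_ ?_)
    · exact (((hS.continuousOn_metricDet he).mono hst).aemeasurable hso.measurableSet).sqrt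
    · exact (hS.aemeasurable_comp_symm he hq).mono_measure (Measure.restrict_mono_set _ hst)

end Local

/-! ### The separated union and its measure -/

section Union

variable {D : ℕ} {J : Type*} {M : J → Set (Euc D)}

lemma separation_le_edist {i j : J} (hij : i ≠ j) {x y : Euc D} (hx : x ∈ M i) (hy : y ∈ M j) :
    separation M ≤ edist x y :=
  (iInf_le_of_le i <| iInf_le_of_le j <| iInf_le_of_le hij <| iInf₂_le_of_le x hx <|
    iInf₂_le_of_le y hy le_rfl)

/-- A ball of radius `separation M` about a point of `M j` meets no other member of the family. -/
lemma isOpenEmbedding_inclusion (hsep : 0 < separation M) (j : J) :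
    IsOpenEmbedding (Set.inclusion (Set.subset_iUnion M j)) := by
  refine ⟨.inclusion _, EMetric.isOpen_iff.2 ?_⟩
  rintro _ ⟨y, rfl⟩
  refine ⟨separation M, hsep, fun z hz => ?_⟩
  obtain ⟨k, hk⟩ := Set.mem_iUnion.1 z.2
  by_cases hkj : k = j
  · subst hkj
    exact ⟨⟨z, hk⟩, rfl⟩
  · exact absurd (separation_le_edist hkj hk y.2) (not_le.2 hz)

lemma measure_restrict_unionVolume (hsep : 0 < separation M) (d : J → ℕ)
    [∀ j, ChartedSpace (Euc (d j)) (M j)] (i : J) {U : Set (M i)} (hU : MeasurableSet U) :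
    (unionVolume M d).restrict (Set.inclusion (Set.subset_iUnion M i) '' U) =
      ((riemannianVolume (d := d i) (M i)).restrict U).map
        (Set.inclusion (Set.subset_iUnion M i)) := by
  have hι := fun j => (isOpenEmbedding_inclusion hsep j).measurableEmbedding
  have hV := (hι i).measurableSet_image.2 hU
  ext B hB
  rw [Measure.restrict_apply hB, unionVolume, Measure.sum_apply _ (hB.inter hV),
    tsum_eq_single i, (hι i).map_apply, (hι i).map_apply,
    Measure.restrict_apply ((hι i).measurable hB), Set.preimage_inter,
    Set.preimage_image_eq _ (hι i).injective]
  -- The other summands vanish: a point common to `M j` and `M i` would force the separation to be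
  -- zero.
  intro j hj
  rw [(hι j).map_apply]
  refine measure_mono_null (t := ∅) ?_ measure_empty
  rintro z ⟨-, y, -, hy⟩
  have h1 : (y : Euc D) = z := congrArg Subtype.val hy
  have h2 := separation_le_edist (M := M) hj z.2 y.2
  rw [h1, edist_self] at h2
  exact absurd h2 (not_le.2 hsep)

variable [Countable J] {d : J → ℕ} [∀ j, ChartedSpace (Euc (d j)) (M j)] {w : J → ℝ}
  {q : (j : J) → M j → ℝ} {p : (⋃ j, M j : Set (Euc D)) → ℝ}

lemma aemeasurable_unionVolume (hsep : 0 < separation M)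
    (hq : ∀ j, AEMeasurable (q j) (riemannianVolume (d := d j) (M j)))
    (hp : ∀ (j : J) (y : M j), p (Set.inclusion (Set.subset_iUnion M j) y) = w j * q j y) :
    AEMeasurable p (unionVolume M d) := by
  refine aemeasurable_sum_measure_iff.2 fun j => ?_
  rw [(isOpenEmbedding_inclusion hsep j).measurableEmbedding.aemeasurable_map_iff]
  exact ((hq j).const_mul (w j)).congr (ae_of_all _ fun y => (hp j y).symm)

omit [Countable J] in
lemma lintegral_unionVolume (hsep : 0 < separation M) (hw : ∀ j, 0 ≤ w j) (hw1 : HasSum w 1)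
    (hq : ∀ j, IsProbDensity (riemannianVolume (d := d j) (M j)) (q j))
    (hp : ∀ (j : J) (y : M j), p (Set.inclusion (Set.subset_iUnion M j) y) = w j * q j y) :
    ∫⁻ y, ENNReal.ofReal (p y) ∂unionVolume M d = 1 := by
  rw [unionVolume, lintegral_sum_measure]
  have : ∀ j, ∫⁻ y, ENNReal.ofReal (p y) ∂(riemannianVolume (d := d j) (M j)).map
      (Set.inclusion (Set.subset_iUnion M j)) = ENNReal.ofReal (w j) := fun j => by
    rw [(isOpenEmbedding_inclusion hsep j).measurableEmbedding.lintegral_map]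
    simp only [hp, ENNReal.ofReal_mul (hw j)]
    rw [lintegral_const_mul' _ _ ENNReal.ofReal_ne_top, (hq j).lintegral_eq_one, mul_one]
  rw [tsum_congr this, ← ENNReal.ofReal_tsum_of_nonneg hw hw1.summable, hw1.tsum_eq,
    ENNReal.ofReal_one]

end Union

/-! ### Moment generating functions and the limiting quotient -/

section Gaussian

open ProbabilityTheory

variable {X : Type*} [MeasurableSpace X] {P : Measure X} [IsFiniteMeasure P] {R : X → ℝ}

/-- For `t < 0` the function `e^(tR)` is bounded by `1`, and `P` is finite. The interior is what
differentiability of the moment generating function requires. -/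
lemma Iio_zero_subset_interior_integrableExpSet (hR : Measurable R) (hR0 : ∀ z, 0 ≤ R z) :
    Set.Iio (0 : ℝ) ⊆ interior (integrableExpSet R P) := by
  rw [← interior_Iio]
  refine interior_mono fun t ht => ?_
  refine Integrable.of_bound (hR.const_mul t).exp.aestronglyMeasurable 1 (ae_of_all _ fun z => ?_)
  rw [Real.norm_eq_abs, Real.abs_exp]
  exact Real.exp_le_one_iff.2 (mul_nonpos_of_nonpos_of_nonneg ht.le (hR0 z))

/-- The logarithmic derivative in `δ` of `∫ exp(-R e^{-2δ} / 2)`. -/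
lemma hasDerivAt_log_mgf_exp [NeZero P] (hR : Measurable R) (hR0 : ∀ z, 0 ≤ R z) (δ : ℝ) :
    HasDerivAt (fun t : ℝ => Real.log (mgf R P (-(1 / 2) * Real.exp (-t) ^ 2)))
      (Real.exp (-δ) ^ 2 * (∫ z, R z * Real.exp (-(1 / 2) * Real.exp (-δ) ^ 2 * R z) ∂P) /
        mgf R P (-(1 / 2) * Real.exp (-δ) ^ 2)) δ := by
  have hneg : -(1 / 2) * Real.exp (-δ) ^ 2 < 0 := by
    have := Real.exp_pos (-δ)
    nlinarith [pow_pos this 2]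
  have hmem := Iio_zero_subset_interior_integrableExpSet (P := P) hR hR0 hneg
  have h1 : HasDerivAt (fun t : ℝ => -(1 / 2) * Real.exp (-t) ^ 2) (Real.exp (-δ) ^ 2) δ := by
    convert! ((((hasDerivAt_id δ).neg).exp).pow 2).const_mul (-(1 / 2) : ℝ) using 1
    simp
    ring
  have h2 := (HasDerivAt.comp (h₂ := mgf R P) δ (hasDerivAt_mgf hmem) h1).log
    (mgf_pos' (NeZero.ne P) (interior_subset (s := integrableExpSet R P) hmem)).ne'
  rw [mul_comm (Real.exp (-δ) ^ 2)]
  exact h2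

omit [IsFiniteMeasure P] in
/-- If `∫ φ(r² R)` is asymptotically `a r^{-d} ∫ φ(‖A u‖²) du` for every `φ` that decays
exponentially, then the logarithmic derivative of `∫ exp(-R e^{-2δ} / 2)` tends to `d`. -/
lemma tendsto_deriv_log_mgf {E F : Type*} [NormedAddCommGroup E] [InnerProductSpace ℝ E]
    [FiniteDimensional ℝ E] [MeasurableSpace E] [BorelSpace E] [NormedAddCommGroup F]
    [NormedSpace ℝ F] {A : E →L[ℝ] F} (hA : Function.Injective A) {a : ℝ} (ha : 0 < a)
    (h : ∀ φ : ℝ → ℝ, Continuous φ →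
      ∀ K : ℝ, (∀ t, 0 ≤ t → |φ t| ≤ K * Real.exp (-(1 / 4) * t)) →
        Tendsto (fun r : ℝ => r ^ Module.finrank ℝ E * ∫ z, φ (r ^ 2 * R z) ∂P) atTop
          (𝓝 (a * ∫ u, φ (‖A u‖ ^ 2)))) :
    Tendsto (fun δ : ℝ =>
      Real.exp (-δ) ^ 2 * (∫ z, R z * Real.exp (-(1 / 2) * Real.exp (-δ) ^ 2 * R z) ∂P) /
        mgf R P (-(1 / 2) * Real.exp (-δ) ^ 2)) atBot (𝓝 (Module.finrank ℝ E)) := by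
  have h0 := h (fun t => Real.exp (-(1 / 2) * t)) (by fun_prop) 1 fun t ht => by
    rw [Real.abs_exp, one_mul, Real.exp_le_exp]
    linarith
  -- The constant `4` comes from `1 + t / 4 ≤ e^(t / 4)`: half of the decay rate is spent on the
  -- factor `t`.
  have h1 := h (fun t => t * Real.exp (-(1 / 2) * t)) (by fun_prop) 4 fun t ht => by
    rw [abs_of_nonneg (by positivity)]
    have : t ≤ 4 * Real.exp (1 / 4 * t) := by
      linarith [Real.add_one_le_exp (1 / 4 * t)]
    calc t * Real.exp (-(1 / 2) * t)
        ≤ 4 * Real.exp (1 / 4 * t) * Real.exp (-(1 / 2) * t) := by gcongr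
      _ = 4 * Real.exp (-(1 / 4) * t) := by
        rw [mul_assoc, ← Real.exp_add]
        ring_nf
  have hI := integral_exp_neg_sq_norm_pos hA
  have hdiv := h1.div h0 (mul_pos ha hI).ne'
  rw [integral_sq_norm_mul_exp_neg hA, mul_div_mul_left _ _ ha.ne',
    mul_div_cancel_right₀ _ hI.ne'] at hdiv
  have hexp : Tendsto (fun δ : ℝ => Real.exp (-δ)) atBot atTop :=
    Real.tendsto_exp_atTop.comp tendsto_neg_atBot_atTop
  refine (hdiv.comp hexp).congr fun δ => ?_
  simp only [Function.comp_apply, Pi.div_apply]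
  rw [mul_div_mul_left _ _ (by positivity), mgf, ← integral_const_mul]
  simp only [mul_assoc]

/-- A set on which `R` is bounded below does not contribute to the Laplace asymptotics. -/
lemma tendsto_pow_mul_setIntegral_of_le {V : Set X} {b : ℝ} (hb : 0 < b)
    (hRb : ∀ z ∈ V, b ≤ R z) {φ : ℝ → ℝ} {K : ℝ}
    (hK : ∀ t, 0 ≤ t → |φ t| ≤ K * Real.exp (-(1 / 4) * t)) (d : ℕ) :
    Tendsto (fun r : ℝ => r ^ d * ∫ z in V, φ (r ^ 2 * R z) ∂P) atTop (𝓝 0) := by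
  have hK0 : 0 ≤ K := by
    have := (abs_nonneg _).trans (hK 0 le_rfl)
    simpa using this
  have hbound : Tendsto (fun r : ℝ => K * P.real V * (r ^ d * Real.exp (-(b / 4) * r))) atTop
      (𝓝 0) := by
    have := (tendsto_rpow_mul_exp_neg_mul_atTop_nhds_zero d (b / 4) (by positivity)).const_mul
      (K * P.real V)
    simpa only [mul_zero, Real.rpow_natCast] using this
  refine squeeze_zero_norm' ?_ hbound
  -- For `r ≥ 1`, `r ^ 2 * R z ≥ b * r` on `V`, so decay linear in the exponent already beats `r ^
  -- d`.
  filter_upwards [eventually_ge_atTop 1] with r hr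
  have h1 : ‖∫ z in V, φ (r ^ 2 * R z) ∂P‖ ≤ K * Real.exp (-(b / 4) * r) * P.real V := by
    refine norm_setIntegral_le_of_norm_le_const (measure_lt_top _ _) fun z hz => ?_
    have hz := hRb z hz
    refine (hK _ (mul_nonneg (sq_nonneg r) (hb.le.trans hz))).trans
      (mul_le_mul_of_nonneg_left (Real.exp_le_exp.2 ?_) hK0)
    nlinarith [mul_le_mul (le_self_pow₀ hr two_ne_zero) hz hb.le (by positivity)]
  rw [norm_mul, norm_pow, Real.norm_of_nonneg (by positivity : (0 : ℝ) ≤ r)]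
  calc r ^ d * ‖∫ z in V, φ (r ^ 2 * R z) ∂P‖
      ≤ r ^ d * (K * Real.exp (-(b / 4) * r) * P.real V) := by gcongr
    _ = _ := by ring

lemma integrable_of_abs_le_exp (hR : Measurable R) (hR0 : ∀ z, 0 ≤ R z) {φ : ℝ → ℝ}
    (hφ : Continuous φ) {K : ℝ} (hK : ∀ t, 0 ≤ t → |φ t| ≤ K * Real.exp (-(1 / 4) * t)) (r : ℝ) :
    Integrable (fun z => φ (r ^ 2 * R z)) P := by
  have hK0 : 0 ≤ K := by
    have := (abs_nonneg _).trans (hK 0 le_rfl)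
    simpa using this
  refine Integrable.of_bound (hφ.measurable.comp (hR.const_mul _)).aestronglyMeasurable K
    (ae_of_all _ fun z => (hK _ (mul_nonneg (sq_nonneg r) (hR0 z))).trans ?_)
  refine mul_le_of_le_one_right hK0 (Real.exp_le_one_iff.2 ?_)
  have := mul_nonneg (sq_nonneg r) (hR0 z)
  linarith

end Gaussian

/-! ### The logarithmic derivative of the Gaussian convolution -/

lemma gaussianDensity_sub_zero {D : ℕ} (x z : Euc D) (δ : ℝ) :
    gaussianDensity (x - z) 0 δ = (2 * Real.pi) ^ (-(D : ℝ) / 2) * Real.exp (-(D : ℝ) * δ) *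
      Real.exp (-(1 / 2) * Real.exp (-δ) ^ 2 * ‖x - z‖ ^ 2) := by
  have : Real.exp (-2 * δ) = Real.exp (-δ) ^ 2 := by
    rw [← Real.exp_nat_mul]
    ring_nf
  rw [gaussianDensity, this, sub_zero]
  ring_nf

end GaussianLID
end

theorem corollary1 {D : ℕ} {J : Type*} [Countable J]
    (d : J → ℕ) (M : J → Set (GaussianLID.Euc D))
    [∀ j, ChartedSpace (GaussianLID.Euc (d j)) (M j)]
    (hM : ∀ j, GaussianLID.IsEmbeddedSubmanifold (d := d j) (M j))
    (hsep : 0 < GaussianLID.separation M)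
    (w : J → ℝ) (hw : ∀ j, 0 < w j) (hw1 : HasSum w 1)
    (q : (j : J) → M j → ℝ)
    (hq : ∀ j, GaussianLID.IsProbDensity (GaussianLID.riemannianVolume (d := d j) (M j)) (q j))
    (p : (⋃ j, M j : Set (GaussianLID.Euc D)) → ℝ)
    (hp : ∀ (j : J) (y : M j), p (Set.inclusion (Set.subset_iUnion M j) y) = w j * q j y)
    (i : J) (x : M i)
    (hcont : ContinuousAt (q i) x) (hpos : 0 < q i x)
    (hmoment : ∫⁻ y, ENNReal.ofReal (q i y) * GaussianLID.geodesicEDist (d := d i) x y ^ 2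
      ∂(GaussianLID.riemannianVolume (d := d i) (M i)) < ⊤) :
    (∀ δ : ℝ, Integrable (fun y : (⋃ j, M j : Set (GaussianLID.Euc D)) =>
        p y * GaussianLID.gaussianDensity ((x : GaussianLID.Euc D) - (y : GaussianLID.Euc D)) 0 δ)
        (GaussianLID.unionVolume M d)) ∧
    (∀ δ : ℝ, 0 < GaussianLID.gaussianConv (GaussianLID.unionVolume M d) p x δ) ∧
    (∀ δ : ℝ, DifferentiableAt ℝ
      (fun t => Real.log (GaussianLID.gaussianConv (GaussianLID.unionVolume M d) p x t)) δ) ∧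
    Tendsto
      (fun δ : ℝ => deriv
        (fun t => Real.log (GaussianLID.gaussianConv (GaussianLID.unionVolume M d) p x t)) δ)
      atBot (𝓝 ((d i : ℝ) - (D : ℝ))) := by
  set μ := GaussianLID.unionVolume M d
  have hpm : AEMeasurable p μ :=
    GaussianLID.aemeasurable_unionVolume hsep (fun j => (hq j).aemeasurable) hp
  have hp0 : ∀ y, 0 ≤ p y := fun y => by
    obtain ⟨j, hj⟩ := Set.mem_iUnion.1 y.2
    exact (hp j ⟨y, hj⟩).symm ▸ mul_nonneg (hw j).le ((hq j).nonneg _)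
  let P : Measure (⋃ j, M j : Set (GaussianLID.Euc D)) :=
    μ.withDensity fun y => ENNReal.ofReal (p y)
  have : IsProbabilityMeasure P := ⟨by
    rw [withDensity_apply _ MeasurableSet.univ, Measure.restrict_univ]
    exact GaussianLID.lintegral_unionVolume hsep (fun j => (hw j).le) hw1 hq hp⟩
  let R : (⋃ j, M j : Set (GaussianLID.Euc D)) → ℝ := fun y =>
    ‖(x : GaussianLID.Euc D) - (y : GaussianLID.Euc D)‖ ^ 2
  have hR : Measurable R := by
    have : Continuous R := by fun_prop
    exact this.measurable
  have hR0 : ∀ y, 0 ≤ R y := fun y => sq_nonneg _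
  have hP : ∀ f : (⋃ j, M j : Set (GaussianLID.Euc D)) → ℝ, ∫ y, f y ∂P = ∫ y, p y * f y ∂μ :=
    fun f => by
      rw [integral_withDensity_eq_integral_toReal_smul₀ hpm.ennreal_ofReal (by simp)]
      simp [hp0]
  have hPint : ∀ f : (⋃ j, M j : Set (GaussianLID.Euc D)) → ℝ, Integrable f P →
      Integrable (fun y => p y * f y) μ := fun f hf => by
    rw [integrable_withDensity_iff_integrable_smul₀' hpm.ennreal_ofReal (by simp)] at hf
    simpa [hp0] using hf
  have hneg : ∀ δ : ℝ, -(1 / 2) * Real.exp (-δ) ^ 2 < 0 := fun δ => by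
    nlinarith [pow_pos (Real.exp_pos (-δ)) 2]
  have hmgfint : ∀ δ : ℝ, Integrable (fun y => Real.exp (-(1 / 2) * Real.exp (-δ) ^ 2 * R y)) P :=
    fun δ => interior_subset (s := ProbabilityTheory.integrableExpSet R P)
      (GaussianLID.Iio_zero_subset_interior_integrableExpSet (P := P) hR hR0 (hneg δ))
  have hconv : ∀ δ, GaussianLID.gaussianConv μ p x δ = (2 * Real.pi) ^ (-(D : ℝ) / 2) *
      Real.exp (-(D : ℝ) * δ) * ProbabilityTheory.mgf R P (-(1 / 2) * Real.exp (-δ) ^ 2) :=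
    fun δ => by
    rw [ProbabilityTheory.mgf, hP, GaussianLID.gaussianConv, ← integral_const_mul]
    refine integral_congr_ae (ae_of_all _ fun y => ?_)
    simp only [GaussianLID.gaussianDensity_sub_zero, R]
    ring
  have hmgf : ∀ δ : ℝ, 0 < ProbabilityTheory.mgf R P (-(1 / 2) * Real.exp (-δ) ^ 2) := fun δ =>
    ProbabilityTheory.mgf_pos (hmgfint δ)
  have hlog : (fun t => Real.log (GaussianLID.gaussianConv μ p x t)) = fun t =>
      Real.log ((2 * Real.pi) ^ (-(D : ℝ) / 2)) + -(D : ℝ) * t +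
        Real.log (ProbabilityTheory.mgf R P (-(1 / 2) * Real.exp (-t) ^ 2)) := by
    funext t
    rw [hconv, Real.log_mul (by positivity) (hmgf t).ne',
      Real.log_mul (by positivity) (Real.exp_pos _).ne', Real.log_exp]
  have hderiv : ∀ δ, HasDerivAt (fun t => Real.log (GaussianLID.gaussianConv μ p x t))
      (-(D : ℝ) + Real.exp (-δ) ^ 2 *
        (∫ z, R z * Real.exp (-(1 / 2) * Real.exp (-δ) ^ 2 * R z) ∂P) /
        ProbabilityTheory.mgf R P (-(1 / 2) * Real.exp (-δ) ^ 2)) δ := fun δ => by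
    rw [hlog]
    refine HasDerivAt.add ?_ (GaussianLID.hasDerivAt_log_mgf_exp hR hR0 δ)
    simpa using ((hasDerivAt_id δ).const_mul (-(D : ℝ))).const_add
      (Real.log ((2 * Real.pi) ^ (-(D : ℝ) / 2)))
  refine ⟨fun δ => ?_, fun δ => ?_, fun δ => (hderiv δ).differentiableAt, ?_⟩
  · refine ((hPint _ (hmgfint δ)).const_mul
      ((2 * Real.pi) ^ (-(D : ℝ) / 2) * Real.exp (-(D : ℝ) * δ))).congr (ae_of_all _ fun y => ?_)
    simp only [GaussianLID.gaussianDensity_sub_zero, R]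
    ring
  · rw [hconv]
    have := hmgf δ
    positivity
  simp only [fun δ => (hderiv δ).deriv]
  rw [sub_eq_neg_add]
  refine Tendsto.const_add _ ?_
  obtain ⟨U, hUo, hxU, A, hA, a, ha, hlim⟩ :=
    (hM i).exists_tendsto_pow_mul_setIntegral (hq i).aemeasurable hcont hpos
  rw [← finrank_euclideanSpace_fin (𝕜 := ℝ) (n := d i)]
  refine GaussianLID.tendsto_deriv_log_mgf hA (mul_pos (hw i) ha) fun φ hφ K hK => ?_
  rw [finrank_euclideanSpace_fin]
  have hι := GaussianLID.isOpenEmbedding_inclusion hsep i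
  set ι := Set.inclusion (Set.subset_iUnion M i)
  have hVo : IsOpen (ι '' U) := hι.isOpenMap U hUo
  -- Openness in the whole union, in the Euclidean distance, gives `R ≥ ε ^ 2` off `ι '' U`, both on
  -- the rest of `M i` and on the other pieces.
  obtain ⟨ε, hε, hball⟩ := Metric.isOpen_iff.1 hVo (ι x) ⟨x, hxU, rfl⟩
  have htail := GaussianLID.tendsto_pow_mul_setIntegral_of_le (P := P)
    (R := R) (V := (ι '' U)ᶜ) (pow_pos hε 2) (fun z hz => ?_) hK (d i)
  · have hsum := ((hlim φ hφ K hK).const_mul (w i)).add htail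
    rw [add_zero, ← mul_assoc] at hsum
    refine hsum.congr fun r => ?_
    rw [← integral_add_compl (μ := P) hVo.measurableSet
      (GaussianLID.integrable_of_abs_le_exp hR hR0 hφ hK r), mul_add, mul_left_comm]
    congr 2
    -- On `ι '' U` the measure `P` is the image of `w i * q i` times the Riemannian measure of `M
    -- i`, which accounts for the factor `w i` in the limit constant.
    have hPV : P.restrict (ι '' U) =
        (μ.restrict (ι '' U)).withDensity fun y => ENNReal.ofReal (p y) :=
      restrict_withDensity hVo.measurableSet _
    rw [hPV, integral_withDensity_eq_integral_toReal_smul₀ hpm.restrict.ennreal_ofReal (by simp),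
      GaussianLID.measure_restrict_unionVolume hsep d i hUo.measurableSet,
      hι.measurableEmbedding.integral_map, ← integral_const_mul]
    refine integral_congr_ae (ae_of_all _ fun y => ?_)
    have h2 : p (ι y) = w i * q i y := hp i y
    beta_reduce
    rw [ENNReal.toReal_ofReal (hp0 _), smul_eq_mul, h2, mul_assoc]
  · by_contra hlt
    refine hz (hball ?_)
    rw [Metric.mem_ball, dist_comm, Subtype.dist_eq, dist_eq_norm]
    exact lt_of_pow_lt_pow_left₀ 2 hε.le (not_le.1 hlt)
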